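/- Let $\mathcal Y$ be a countably infinite alphabet and let $\mathbf Y_i=\{Y_i^n\}_{n\ge 1}$ ($i=1,2$) be i.i.d. sources with letters $Y_i$ in $\mathcal Y$, so that $P_{Y_i^n}(y_1\cdots y_n)=\prod_{k=1}^n P_{Y_i}(y_k)$. Let $H(Y_i)=\sum_{y\in\mathcal Y}P_{Y_i}(y)\log\frac1{P_{Y_i}(y)}$ be the entropy and $\sigma_i^2=E\bigl(\log\frac1{P_{Y_i}(Y_i)}-H(Y_i)\bigr)^2$ the varentropy (natural logarithms), both assumed finite, with $\sigma_i\ge 0$. Let $w(1),w(2)>0$ with $w(1)+w(2)=1$, and let $\mathbf Y=\{Y^n\}_{n\ge 1}$ be the mixed source $P_{Y^n}=w(1)P_{Y_1^n}+w(2)P_{Y_2^n}$ on $\mathcal Y^n$. For $a,\delta\in\mathbb R$, a real number $R$ is called $(a,\delta)$-achievable if there are integers $M_n\ge 1$ and maps $\phi_n:\{1,\dots,M_n\}\to\mathcal Y^n$ such that $$\limsup_{n\to\infty}\frac1{\sqrt n}\log\frac{M_n}{e^{na}}\le R\quad\text{and}\quad \limsup_{n\to\infty}d\bigl(Y^n,\phi_n(U_{M_n})\bigr)\le\delta,$$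 where $U_M$ is uniformly distributed on $\{1,\dots,M\}$ and $d(Z,\overline Z)=\sum_z|P_Z(z)-P_{\overline Z}(z)|$. The second-order resolvability is $S_r(a,\delta|\mathbf Y)=\inf\{R: R\text{ is }(a,\delta)\text{-achievable}\}\in[-\infty,+\infty]$. Let $Q(x)=\int_x^\infty\frac1{\sqrt{2\pi}}e^{-z^2/2}\,dz$ for $x\in[-\infty,+\infty]$, so that $Q(+\infty)=0$ and $Q(-\infty)=1$. Let $0\le\delta<2$. Case I: if $H(Y_1)=H(Y_2)$ and $\sigma_1,\sigma_2>0$, then $S_r(H(Y_1),\delta|\mathbf Y)=T_1$, where $T_1\in[-\infty,+\infty]$ is the unique solution of $$\frac\delta2=w(1)\,Q\Bigl(\frac{T_1}{\sigma_1}\Bigr)+w(2)\,Q\Bigl(\frac{T_1}{\sigma_2}\Bigr).$$ Case II: if $H(Y_1)>H(Y_2)$, $w(1)>\frac\delta2$ and $\sigma_1>0$, then $S_r(H(Y_1),\delta|\mathbf Y)=T_2$, where $T_2\in[-\infty,+\infty]$ is the unique solution of $$\frac\delta2=w(1)\,Q\Bigl(\frac{T_2}{\sigma_1}\Bigr).$$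 Case III: if $H(Y_1)>H(Y_2)$, $w(1)<\frac\delta2$ and $\sigma_2>0$, then $S_r(H(Y_2),\delta|\mathbf Y)=T_3$, where $T_3\in[-\infty,+\infty]$ is the unique solution of $$\frac\delta2=w(1)+w(2)\,Q\Bigl(\frac{T_3}{\sigma_2}\Bigr).$$ -/

import Mathlib

open Filter
open scoped BigOperators

noncomputable section

namespace SecondOrder

variable {𝒴 𝒵 : Type*}

/-- Variational distance `∑_z |P(z) - Q(z)|` (without the factor `1/2`); the series always
converges. -/
def varDist (P Q : PMF 𝒵) : ℝ :=
  ∑' z, |(P z).toReal - (Q z).toReal|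

/-- `R` is `(a, δ)`-achievable for the general source `Y = {Yⁿ}`, `Yⁿ` with values in `𝒴ⁿ n`:
there are sizes `M n ≥ 1` and maps `φ n : {1, …, M n} → 𝒴ⁿ n` with
`limsup (1/√n) log (M n / e^{na}) ≤ R` and `limsup d(Yⁿ, φ n (U_{M n})) ≤ δ`, where `U_M` is
uniform on a set of size `M`. The upper limits are taken in the extended reals. -/
def IsAchievable {𝒴ₙ : ℕ → Type*} (a δ : ℝ) (Y : ∀ n, PMF (𝒴ₙ n)) (R : ℝ) : Prop :=
  ∃ (M : ℕ → ℕ+) (φ : ∀ n, Fin (M n) → 𝒴ₙ n),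
    limsup (fun n : ℕ =>
      ((1 / √(n : ℝ) * Real.log (((M n : ℕ) : ℝ) / Real.exp (n * a)) : ℝ) : EReal)) atTop
        ≤ (R : EReal) ∧
    limsup (fun n : ℕ =>
      ((varDist (Y n) ((PMF.uniformOfFintype (Fin (M n))).map (φ n)) : ℝ) : EReal)) atTop
        ≤ (δ : EReal)

/-- Second-order resolvability `S_r(a, δ | Y)`: the infimum, in the extended reals, of the
`(a, δ)`-achievable rates (it is `+∞` if there are none). -/
def resolvability {𝒴ₙ : ℕ → Type*} (a δ : ℝ) (Y : ∀ n, PMF (𝒴ₙ n)) : EReal :=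
  sInf ((fun R : ℝ => (R : EReal)) '' {R : ℝ | IsAchievable a δ Y R})

theorem tsum_prod_eq_one (P : PMF 𝒴) (n : ℕ) :
    ∑' y : Fin n → 𝒴, ∏ k, P (y k) = 1 := by
  induction n with
  | zero => simp
  | succ n ih =>
    rw [← (Fin.consEquiv (fun _ : Fin (n + 1) => 𝒴)).tsum_eq, ENNReal.tsum_prod']
    simp only [Fin.consEquiv_apply, Fin.prod_univ_succ, Fin.cons_zero, Fin.cons_succ]
    simp only [ENNReal.tsum_mul_left, ih, mul_one, P.tsum_coe]

/-- The law of `n` i.i.d. letters with law `P`: `P_{Yⁿ}(y) = ∏ k, P(y k)`. -/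
def iidSource (P : PMF 𝒴) (n : ℕ) : PMF (Fin n → 𝒴) :=
  ⟨fun y => ∏ k, P (y k), by
    rw [← tsum_prod_eq_one P n]
    exact ENNReal.summable.hasSum⟩

/-- The mixture `w₁ P + w₂ Q` of two laws. -/
def mixture (w₁ w₂ : ℝ) (h₁ : 0 < w₁) (h₂ : 0 < w₂) (h : w₁ + w₂ = 1) (P Q : PMF 𝒵) : PMF 𝒵 :=
  ⟨fun z => ENNReal.ofReal w₁ * P z + ENNReal.ofReal w₂ * Q z, by
    have key : ∑' z, (ENNReal.ofReal w₁ * P z + ENNReal.ofReal w₂ * Q z) = 1 := by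
      rw [ENNReal.tsum_add, ENNReal.tsum_mul_left, ENNReal.tsum_mul_left, P.tsum_coe,
        Q.tsum_coe, mul_one, mul_one, ← ENNReal.ofReal_add h₁.le h₂.le, h, ENNReal.ofReal_one]
    rw [← key]
    exact ENNReal.summable.hasSum⟩

/-- The mixed source `P_{Yⁿ} = w₁ P_{Y₁ⁿ} + w₂ P_{Y₂ⁿ}` of two i.i.d. sources. -/
def mixedSource (w₁ w₂ : ℝ) (h₁ : 0 < w₁) (h₂ : 0 < w₂) (h : w₁ + w₂ = 1) (P₁ P₂ : PMF 𝒴)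
    (n : ℕ) : PMF (Fin n → 𝒴) :=
  mixture w₁ w₂ h₁ h₂ h (iidSource P₁ n) (iidSource P₂ n)

/-- Self-information `log (1 / P(y))`, natural logarithm. -/
def selfInfo (P : PMF 𝒴) (y : 𝒴) : ℝ :=
  Real.log (1 / (P y).toReal)

/-- Entropy `H = ∑_y P(y) log (1 / P(y))`. -/
def entropy (P : PMF 𝒴) : ℝ :=
  ∑' y, (P y).toReal * selfInfo P y

/-- Varentropy `σ² = ∑_y P(y) (log (1 / P(y)) - H)²`. -/
def varentropy (P : PMF 𝒴) : ℝ :=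
  ∑' y, (P y).toReal * (selfInfo P y - entropy P) ^ 2

/-- The entropy and the varentropy are finite, i.e. both series converge. -/
def FiniteVarentropy (P : PMF 𝒴) : Prop :=
  (Summable fun y => (P y).toReal * selfInfo P y) ∧
    Summable fun y => (P y).toReal * (selfInfo P y - entropy P) ^ 2

/-- The standard deviation `σ` of the self-information. -/
def sigma (P : PMF 𝒴) : ℝ :=
  √(varentropy P)

/-- Gaussian tail `Q(x) = ∫_x^∞ (1/√(2π)) exp (-z²/2) dz`, for extended real `x`. -/
def gaussianTail (x : EReal) : ℝ :=
  ∫ z in {z : ℝ | x ≤ (z : EReal)}, 1 / √(2 * Real.pi) * Real.exp (-z ^ 2 / 2)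

end SecondOrder

end

open MeasureTheory ProbabilityTheory
open scoped Topology

noncomputable section

namespace SecondOrder

variable {𝒴 𝒵 : Type*}

/-! Everything rests on the information spectrum `G t`, the limit of the probability that the
self-information of `Yⁿ` exceeds `n a + √n t`. An image of the uniform law on `M` points misses
nearly all the mass of atoms much lighter than `1/M`, since it charges at most `M` points
(`prob_lt_le_varDist_map`). Atoms much heavier than `1/M` are reproduced with small relative error
by rounding down to multiples of `1/M` (`exists_varDist_map_le`). With `M ≈ e^{na + √n R}`, any gap
between `R` and `t` makes both errors exponentially small in `√n`, so the resolvability is the point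
where `G` crosses `δ/2` (`resolvability_eq_of_tendsto_specTail`).

For a mixture, under component `i` the self-information of the mixture exceeds that of the component
by at most `-log wᵢ`, and by a change of measure it is rarely smaller by order `√n`. Hence `G = w₁
G₁ + w₂ G₂` (`tendsto_specTail_mixedSource`). At `a = H(Yᵢ)` the central limit theorem gives a
Gaussian tail for `Gᵢ`; when `a ≠ H(Yᵢ)` the law of large numbers gives the constant 0 or 1. Strict
monotonicity and continuity of the Gaussian tail on the extended reals give the unique solution. -/

/-! ### Masses of sets and variational distance -/

theorem hasSum_toReal (p : PMF 𝒵) : HasSum (fun z => (p z).toReal) 1 := by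
  have h := (ENNReal.summable_toReal p.tsum_coe_ne_top).hasSum
  rwa [← ENNReal.tsum_toReal_eq p.apply_ne_top, p.tsum_coe, ENNReal.toReal_one] at h

theorem summable_toReal (p : PMF 𝒵) : Summable fun z => (p z).toReal :=
  (hasSum_toReal p).summable

/-- The real probability of a set under a law. -/
def prob (p : PMF 𝒵) (S : Set 𝒵) : ℝ :=
  ∑' z, S.indicator (fun z => (p z).toReal) z

theorem summable_indicator_toReal (p : PMF 𝒵) (S : Set 𝒵) :
    Summable (S.indicator fun z => (p z).toReal) :=
  (summable_toReal p).indicator S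

theorem prob_mono (p : PMF 𝒵) {S T : Set 𝒵} (h : S ⊆ T) : prob p S ≤ prob p T :=
  (summable_indicator_toReal p S).tsum_le_tsum
    (Set.indicator_le_indicator_of_subset h fun _ => ENNReal.toReal_nonneg)
    (summable_indicator_toReal p T)

theorem prob_le_add (p : PMF 𝒵) {S T U : Set 𝒵} (h : S ⊆ T ∪ U) :
    prob p S ≤ prob p T + prob p U := by
  rw [prob, prob, prob,
    ← (summable_indicator_toReal p T).tsum_add (summable_indicator_toReal p U)]
  refine (summable_indicator_toReal p S).tsum_le_tsum (fun z => ?_)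
    ((summable_indicator_toReal p T).add (summable_indicator_toReal p U))
  have h0 : 0 ≤ (p z).toReal := ENNReal.toReal_nonneg
  by_cases hS : z ∈ S
  · rcases h hS with hT | hU
    · simp only [Set.indicator_of_mem hS, Set.indicator_of_mem hT]
      linarith [Set.indicator_nonneg (s := U) (fun z _ => (p z).toReal_nonneg) z]
    · simp only [Set.indicator_of_mem hS, Set.indicator_of_mem hU]
      linarith [Set.indicator_nonneg (s := T) (fun z _ => (p z).toReal_nonneg) z]
  · simp only [Set.indicator_of_notMem hS]
    exact add_nonneg (Set.indicator_nonneg (fun z _ => (p z).toReal_nonneg) z)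
      (Set.indicator_nonneg (fun z _ => (p z).toReal_nonneg) z)

theorem summable_abs_sub (p q : PMF 𝒵) :
    Summable fun z => |(p z).toReal - (q z).toReal| :=
  ((summable_toReal p).sub (summable_toReal q)).abs

theorem hasSum_sub_toReal (p q : PMF 𝒵) :
    HasSum (fun z => (p z).toReal - (q z).toReal) 0 := by
  simpa using (hasSum_toReal p).sub (hasSum_toReal q)

/-- As `p - q` sums to 0, the left side is the sum of `p - q` on `B` and `q - p` off `B`, each at
most `|p - q|`. -/
theorem two_mul_prob_sub_le_varDist (p q : PMF 𝒵) (B : Set 𝒵) :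
    2 * (prob p B - prob q B) ≤ varDist p q := by
  have hB := (summable_indicator_toReal p B).hasSum.sub (summable_indicator_toReal q B).hasSum
  have h := (hB.mul_left 2).sub (hasSum_sub_toReal p q)
  rw [sub_zero] at h
  refine hasSum_le (fun z => ?_) h (summable_abs_sub p q).hasSum
  by_cases hz : z ∈ B
  · simp only [Set.indicator_of_mem hz]
    linarith [le_abs_self ((p z).toReal - (q z).toReal)]
  · simp only [Set.indicator_of_notMem hz]
    linarith [neg_abs_le ((p z).toReal - (q z).toReal)]

/-- `|x| = 2x⁺ - x` and `p - q` sums to 0, so only the positive part of `p - q` has to be bounded.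
-/
theorem varDist_le_two_mul_of_sub_le (p q : PMF 𝒵) {f : 𝒵 → ℝ} {s : ℝ} (hf : HasSum f s)
    (h0 : ∀ z, 0 ≤ f z) (h : ∀ z, (p z).toReal - (q z).toReal ≤ f z) :
    varDist p q ≤ 2 * s := by
  have h' := (hf.mul_left 2).sub (hasSum_sub_toReal p q)
  rw [sub_zero] at h'
  refine hasSum_le (fun z => ?_) (summable_abs_sub p q).hasSum h'
  rcases abs_cases ((p z).toReal - (q z).toReal) with ⟨h1, -⟩ | ⟨h1, -⟩ <;> rw [h1] <;>
    linarith [h z, h0 z]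

/-! ### Approximation by images of uniform laws -/

/-- An image of a uniform law on `M` points misses most of the mass of the light atoms of `p`. -/
theorem prob_lt_le_varDist_map (p : PMF 𝒵) (M : ℕ+) (φ : Fin M → 𝒵) {c θ : ℝ}
    (hθ : 0 ≤ θ) (hc : (M : ℕ) * θ ≤ c) :
    prob p {z | (p z).toReal < θ} ≤
      varDist p ((PMF.uniformOfFintype (Fin M)).map φ) / 2 + c := by
  classical
  set q := (PMF.uniformOfFintype (Fin M)).map φ with hq
  set A := {z | (p z).toReal < θ}
  have hq0 : prob q (A \ Set.range φ) = 0 := by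
    rw [prob, tsum_congr (g := fun _ => (0 : ℝ)), tsum_zero]
    intro z
    by_cases hz : z ∈ A \ Set.range φ
    · rw [Set.indicator_of_mem hz]
      have : z ∉ q.support := by
        rw [hq, PMF.support_map]
        rintro ⟨x, -, hx⟩
        exact hz.2 ⟨x, hx⟩
      rw [(PMF.apply_eq_zero_iff q z).2 this, ENNReal.toReal_zero]
    · rw [Set.indicator_of_notMem hz]
  have h1 := two_mul_prob_sub_le_varDist p q (A \ Set.range φ)
  have h2 : prob p A ≤ prob p (A \ Set.range φ) + prob p (A ∩ Set.range φ) :=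
    prob_le_add p fun z hz => by
      by_cases h : z ∈ Set.range φ
      · exact Or.inr ⟨hz, h⟩
      · exact Or.inl ⟨hz, h⟩
  have h3 : prob p (A ∩ Set.range φ) ≤ c := by
    have hsupp : ∀ z ∉ Finset.univ.image φ,
        (A ∩ Set.range φ).indicator (fun z => (p z).toReal) z = 0 := by
      intro z hz
      refine Set.indicator_of_notMem (fun h => hz ?_) _
      obtain ⟨x, hx⟩ := h.2
      exact Finset.mem_image.2 ⟨x, Finset.mem_univ _, hx⟩
    rw [prob, tsum_eq_sum hsupp]
    calc _ ≤ ∑ _z ∈ Finset.univ.image φ, θ := by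
          refine Finset.sum_le_sum fun z _ => ?_
          by_cases hz : z ∈ A ∩ Set.range φ
          · rw [Set.indicator_of_mem hz]
            exact le_of_lt hz.1
          · rwa [Set.indicator_of_notMem hz]
      _ = (Finset.univ.image φ).card * θ := by simp
      _ ≤ (M : ℕ) * θ := by
          gcongr
          simpa using Finset.card_image_le (s := (Finset.univ : Finset (Fin M))) (f := φ)
      _ ≤ c := hc
  linarith

/-- A law `p` is approximated by an image of the uniform law on `M` points up to the mass of
its light atoms. -/
theorem exists_varDist_map_le (p : PMF 𝒵) (M : ℕ+) {c : ℝ} (hc : 0 < c) :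
    ∃ φ : Fin M → 𝒵, varDist p ((PMF.uniformOfFintype (Fin M)).map φ) ≤
      2 * (prob p {z | c * M * (p z).toReal < 1} + c) := by
  classical
  have hM : (0 : ℝ) < (M : ℕ) := by exact_mod_cast M.pos
  have hcM : 0 < c * (M : ℕ) := mul_pos hc hM
  have hfin : {z | ¬ c * (M : ℕ) * (p z).toReal < 1}.Finite := by
    have h := (summable_toReal p).tendsto_cofinite_zero.eventually_lt_const
      (inv_pos.2 hcM)
    rw [eventually_cofinite] at h
    refine h.subset fun z hz hlt => hz ?_
    calc _ < c * (M : ℕ) * (c * (M : ℕ))⁻¹ := by gcongr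
      _ = 1 := mul_inv_cancel₀ hcM.ne'
  set A : Finset 𝒵 := hfin.toFinset with hA
  -- Each heavy atom receives its mass rounded down to a multiple of `1/M`; the counts total at most
  -- `M`, so disjoint blocks of indices exist.
  let k : 𝒵 → ℕ := fun z => ⌊(M : ℕ) * (p z).toReal⌋₊
  have hk : ∑ z ∈ A, k z ≤ (M : ℕ) := by
    have : ∑ z ∈ A, (k z : ℝ) ≤ (M : ℕ) * ∑ z ∈ A, (p z).toReal := by
      rw [Finset.mul_sum]
      exact Finset.sum_le_sum fun z _ => Nat.floor_le (by positivity)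
    have h1 : ∑ z ∈ A, (p z).toReal ≤ 1 :=
      sum_le_hasSum A (fun _ _ => ENNReal.toReal_nonneg) (hasSum_toReal p)
    have h2 : ∑ z ∈ A, (k z : ℝ) ≤ (M : ℕ) := by nlinarith
    exact_mod_cast h2
  obtain ⟨e⟩ : Nonempty ((Σ z : A, Fin (k z)) ↪ Fin M) := by
    refine Function.Embedding.nonempty_of_card_le ?_
    simp only [Fintype.card_sigma, Fintype.card_fin]
    rwa [Finset.sum_coe_sort A k]
  obtain ⟨z₀, -⟩ := p.support_nonempty
  -- Leftover indices go to an arbitrary point: surplus mass of the image does not enter the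
  -- one-sided bound.
  let φ : Fin M → 𝒵 := Function.extend e (fun x => (x.1 : 𝒵)) fun _ => z₀
  refine ⟨φ, ?_⟩
  have hcount : ∀ z ∈ A, (k z : ℝ) / (M : ℕ) ≤
      (((PMF.uniformOfFintype (Fin M)).map φ) z).toReal := by
    intro z hz
    have hcard : k z ≤ (Finset.univ.filter fun x => z = φ x).card := by
      have hinj : Function.Injective fun i : Fin (k z) => e ⟨⟨z, hz⟩, i⟩ := by
        intro i j hij
        simpa using e.injective hij
      rw [← Fintype.card_fin (k z), ← Finset.card_univ,
        ← Finset.card_image_of_injective _ hinj]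
      refine Finset.card_le_card fun x hx => ?_
      obtain ⟨i, -, rfl⟩ := Finset.mem_image.1 hx
      simp [φ, e.injective.extend_apply]
    have hval : (((PMF.uniformOfFintype (Fin M)).map φ) z).toReal =
        (Finset.univ.filter fun x => z = φ x).card / (M : ℕ) := by
      rw [PMF.map_apply, tsum_fintype]
      simp only [PMF.uniformOfFintype_apply, Fintype.card_fin]
      rw [← Finset.sum_filter, Finset.sum_const, nsmul_eq_mul, ENNReal.toReal_mul,
        ENNReal.toReal_inv, ENNReal.toReal_natCast, ENNReal.toReal_natCast, div_eq_mul_inv]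
    rw [hval]
    gcongr
  refine varDist_le_two_mul_of_sub_le p _
    ((summable_indicator_toReal p _).hasSum.add ?_)
    (f := fun z => {z | c * (M : ℕ) * (p z).toReal < 1}.indicator (fun z => (p z).toReal) z +
      c * (p z).toReal) (fun z => ?_) fun z => ?_
  · simpa using (hasSum_toReal p).mul_left c
  · have := Set.indicator_nonneg (s := {z | c * (M : ℕ) * (p z).toReal < 1})
      (fun z _ => (p z).toReal_nonneg) z
    have := (p z).toReal_nonneg
    positivity
  · have hq : 0 ≤ (((PMF.uniformOfFintype (Fin M)).map φ) z).toReal := ENNReal.toReal_nonneg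
    have hp := (p z).toReal_nonneg
    -- A light atom may be lost entirely; a heavy one loses at most `1/M`, which is at most `c`
    -- times its mass.
    by_cases hz : c * (M : ℕ) * (p z).toReal < 1
    · rw [Set.indicator_of_mem (by exact hz)]
      nlinarith
    · rw [Set.indicator_of_notMem (by exact hz), zero_add]
      have h1 := hcount z (by simpa [hA] using hz)
      have h2 : (M : ℕ) * (p z).toReal < k z + 1 := Nat.lt_floor_add_one _
      have h3 : (p z).toReal - c * (p z).toReal ≤ (k z : ℝ) / (M : ℕ) := by
        rw [le_div_iff₀ hM]
        nlinarith
      linarith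

/-! ### Resolvability from the limiting spectrum -/

theorem tendsto_exp_neg_mul_sqrt {γ : ℝ} (hγ : 0 < γ) :
    Tendsto (fun n : ℕ => Real.exp (-(γ * √(n : ℝ)))) atTop (𝓝 0) :=
  Real.tendsto_exp_neg_atTop_nhds_zero.comp <|
    (Real.tendsto_sqrt_atTop.comp tendsto_natCast_atTop_atTop).const_mul_atTop hγ

/-- The probability, under `p`, that the normalised self-information of `q` exceeds `t`. -/
def specTail (p q : PMF 𝒵) (a t : ℝ) (n : ℕ) : ℝ :=
  prob p {z | (q z).toReal < Real.exp (-(n * a + √(n : ℝ) * t))}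

section Resolvability

variable {𝒴ₙ : ℕ → Type*} {a δ : ℝ} {Y : ∀ n, PMF (𝒴ₙ n)} {G : ℝ → ℝ}

theorem isAchievable_of_tendsto_specTail (ha : 0 < a) {R t : ℝ} (ht : t < R) {g : ℝ}
    (hlim : Tendsto (fun n => specTail (Y n) (Y n) a t n) atTop (𝓝 g)) (hg : g ≤ δ / 2) :
    IsAchievable a δ Y R := by
  let x : ℕ → ℝ := fun n => n * a + √(n : ℝ) * R
  let M : ℕ → ℕ+ := fun n => ⟨⌈Real.exp (x n)⌉₊, Nat.ceil_pos.2 (Real.exp_pos _)⟩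
  have hMle : ∀ n, Real.exp (x n) ≤ ((M n : ℕ) : ℝ) := fun n => Nat.le_ceil _
  choose φ hφ using fun n => exists_varDist_map_le (Y n) (M n)
    (Real.exp_pos (-((R - t) * √(n : ℝ))))
  refine ⟨M, φ, ?_, ?_⟩
  · have hsqrt : Tendsto (fun n : ℕ => √(n : ℝ)) atTop atTop :=
      Real.tendsto_sqrt_atTop.comp tendsto_natCast_atTop_atTop
    -- Since `0 < a`, the exponent is eventually nonnegative even if `R < 0`, so the ceiling at most
    -- doubles `M n`.
    have hxpos : ∀ᶠ n : ℕ in atTop, 0 ≤ x n := by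
      filter_upwards [hsqrt.eventually_ge_atTop (-R / a)] with n hn
      have h1 : (n : ℝ) = √(n : ℝ) * √(n : ℝ) := (Real.mul_self_sqrt (Nat.cast_nonneg n)).symm
      have h2 : 0 ≤ √(n : ℝ) * a + R := by
        rw [div_le_iff₀ ha] at hn
        linarith
      have h3 : x n = √(n : ℝ) * (√(n : ℝ) * a + R) := by
        simp only [x]
        linear_combination a * h1
      rw [h3]
      positivity
    have hbound : Tendsto (fun n : ℕ => R + Real.log 2 / √(n : ℝ)) atTop (𝓝 R) := by
      simpa using (hsqrt.const_div_atTop (Real.log 2)).const_add R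
    have hE := (continuous_coe_real_ereal.tendsto R).comp hbound
    rw [← hE.limsup_eq]
    refine limsup_le_limsup ?_
    filter_upwards [hxpos, eventually_gt_atTop 0] with n hn hn0
    have hs : 0 < √(n : ℝ) := Real.sqrt_pos.2 (by exact_mod_cast hn0)
    simp only [Function.comp_apply, EReal.coe_le_coe_iff]
    have h2 : ((M n : ℕ) : ℝ) ≤ 2 * Real.exp (x n) := by
      have h1 : ((M n : ℕ) : ℝ) < Real.exp (x n) + 1 := Nat.ceil_lt_add_one (Real.exp_pos _).le
      linarith [Real.one_le_exp hn]
    have hM : (0 : ℝ) < (M n : ℕ) := by exact_mod_cast (M n).pos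
    have h3 : Real.log ((M n : ℕ) / Real.exp (n * a)) ≤ Real.log 2 + √(n : ℝ) * R := by
      rw [Real.log_div hM.ne' (Real.exp_pos _).ne', Real.log_exp]
      have := Real.log_le_log hM h2
      rw [Real.log_mul two_ne_zero (Real.exp_pos _).ne', Real.log_exp] at this
      simp only [x] at this
      linarith
    calc 1 / √(n : ℝ) * Real.log ((M n : ℕ) / Real.exp (n * a))
        ≤ 1 / √(n : ℝ) * (Real.log 2 + √(n : ℝ) * R) := by gcongr
      _ = R + Real.log 2 / √(n : ℝ) := by field_simp; ring
  · have hb : Tendsto (fun n : ℕ => 2 * (specTail (Y n) (Y n) a t n +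
        Real.exp (-((R - t) * √(n : ℝ))))) atTop (𝓝 (2 * (g + 0))) :=
      (hlim.add (tendsto_exp_neg_mul_sqrt (sub_pos.2 ht))).const_mul 2
    have hE := (continuous_coe_real_ereal.tendsto _).comp hb
    have hle : ((2 * (g + 0) : ℝ) : EReal) ≤ (δ : EReal) := by
      rw [EReal.coe_le_coe_iff]
      linarith
    refine le_trans ?_ hle
    rw [← hE.limsup_eq]
    refine limsup_le_limsup (Eventually.of_forall fun n => ?_)
    simp only [Function.comp_apply, EReal.coe_le_coe_iff]
    refine (hφ n).trans ?_
    gcongr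
    -- The relative error times `M n` is at least `e^{na + √n t}`, so the lost atoms are counted by
    -- the spectrum at `t`.
    refine prob_mono _ fun z hz => ?_
    simp only [Set.mem_ofPred_eq] at hz ⊢
    by_contra! hcon
    refine hz.not_ge ?_
    calc (1 : ℝ) = Real.exp (-((R - t) * √(n : ℝ))) * Real.exp (x n) *
          Real.exp (-(n * a + √(n : ℝ) * t)) := by
          rw [← Real.exp_add, ← Real.exp_add, eq_comm, Real.exp_eq_one_iff]
          simp only [x]
          ring
      _ ≤ _ := by
          gcongr
          exact hMle n

theorem le_of_isAchievable {R t g : ℝ} (hR : IsAchievable a δ Y R) (ht : R < t)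
    (hlim : Tendsto (fun n => specTail (Y n) (Y n) a t n) atTop (𝓝 g)) : g ≤ δ / 2 := by
  obtain ⟨M, φ, hM, hφ⟩ := hR
  -- The limsup bounds `M n` only at rates above `R`; the remaining gap `t - s` makes the covered
  -- mass of light atoms vanish.
  obtain ⟨s, hRs, hst⟩ := exists_between ht
  refine le_of_forall_gt_imp_ge_of_dense fun b hb => ?_
  have hM' := eventually_lt_of_limsup_lt (hM.trans_lt (EReal.coe_lt_coe_iff.2 hRs))
  have hφ' := eventually_lt_of_limsup_lt
    (hφ.trans_lt (EReal.coe_lt_coe_iff.2 (show δ < 2 * b by linarith)))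
  have hlim' : Tendsto (fun n : ℕ => b + Real.exp (-((t - s) * √(n : ℝ)))) atTop (𝓝 (b + 0)) :=
    (tendsto_exp_neg_mul_sqrt (sub_pos.2 hst)).const_add b
  rw [add_zero] at hlim'
  refine le_of_tendsto_of_tendsto hlim hlim' ?_
  filter_upwards [hM', hφ', eventually_gt_atTop 0] with n h1 h2 hn0
  rw [EReal.coe_lt_coe_iff] at h1 h2
  have hs : 0 < √(n : ℝ) := Real.sqrt_pos.2 (by exact_mod_cast hn0)
  have hMpos : (0 : ℝ) < (M n : ℕ) := by exact_mod_cast (M n).pos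
  have h3 : ((M n : ℕ) : ℝ) ≤ Real.exp (n * a + √(n : ℝ) * s) := by
    rw [one_div, inv_mul_lt_iff₀ hs, Real.log_div hMpos.ne' (Real.exp_pos _).ne',
      Real.log_exp] at h1
    rw [← Real.log_le_iff_le_exp hMpos]
    linarith
  have h4 := prob_lt_le_varDist_map (Y n) (M n) (φ n)
    (θ := Real.exp (-(n * a + √(n : ℝ) * t))) (c := Real.exp (-((t - s) * √(n : ℝ))))
    (Real.exp_pos _).le (by
      calc _ ≤ Real.exp (n * a + √(n : ℝ) * s) * Real.exp (-(n * a + √(n : ℝ) * t)) := by gcongr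
        _ = _ := by
          rw [← Real.exp_add]
          ring_nf)
  simp only [specTail]
  linarith

/-- The second-order resolvability is the level at which the limiting information spectrum
crosses `δ / 2`. -/
theorem resolvability_eq_of_tendsto_specTail (ha : 0 < a)
    (hlim : ∀ t, Tendsto (fun n => specTail (Y n) (Y n) a t n) atTop (𝓝 (G t))) {T : EReal}
    (hlt : ∀ t : ℝ, (t : EReal) < T → δ / 2 < G t) (hgt : ∀ t : ℝ, T < t → G t < δ / 2) :
    resolvability a δ Y = T := by
  refine le_antisymm ?_ ?_
  · refine EReal.le_of_forall_lt_iff_le.1 fun R hR => ?_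
    obtain ⟨t, hTt, htR⟩ := EReal.lt_iff_exists_real_btwn.1 hR
    exact sInf_le ⟨R, isAchievable_of_tendsto_specTail ha (EReal.coe_lt_coe_iff.1 htR) (hlim t)
      (hgt t hTt).le, rfl⟩
  · refine le_sInf ?_
    rintro _ ⟨R, hR, rfl⟩
    by_contra! hRT
    obtain ⟨t, hRt, htT⟩ := EReal.lt_iff_exists_real_btwn.1 hRT
    exact (hlt t htT).not_ge (le_of_isAchievable hR (EReal.coe_lt_coe_iff.1 hRt) (hlim t))

end Resolvability

/-! ### Spectrum of a mixture -/

theorem prob_mixture (w₁ w₂ : ℝ) (h₁ : 0 < w₁) (h₂ : 0 < w₂) (h : w₁ + w₂ = 1) (p q : PMF 𝒵)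
    (S : Set 𝒵) : prob (mixture w₁ w₂ h₁ h₂ h p q) S = w₁ * prob p S + w₂ * prob q S := by
  have hz : ∀ z, (mixture w₁ w₂ h₁ h₂ h p q z).toReal =
      w₁ * (p z).toReal + w₂ * (q z).toReal := fun z => by
    change (ENNReal.ofReal w₁ * p z + ENNReal.ofReal w₂ * q z).toReal = _
    rw [ENNReal.toReal_add (ENNReal.mul_ne_top ENNReal.ofReal_ne_top (p.apply_ne_top z))
      (ENNReal.mul_ne_top ENNReal.ofReal_ne_top (q.apply_ne_top z)), ENNReal.toReal_mul,
      ENNReal.toReal_mul, ENNReal.toReal_ofReal h₁.le, ENNReal.toReal_ofReal h₂.le]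
  rw [prob, prob, prob, ← tsum_mul_left, ← tsum_mul_left,
    ← ((summable_indicator_toReal p S).mul_left w₁).tsum_add
      ((summable_indicator_toReal q S).mul_left w₂)]
  refine tsum_congr fun z => ?_
  by_cases hS : z ∈ S
  · simp only [Set.indicator_of_mem hS, hz]
  · simp only [Set.indicator_of_notMem hS, mul_zero, add_zero]

theorem le_mixture_left (w₁ w₂ : ℝ) (h₁ : 0 < w₁) (h₂ : 0 < w₂) (h : w₁ + w₂ = 1) (p q : PMF 𝒵)
    (z : 𝒵) : ENNReal.ofReal w₁ * p z ≤ mixture w₁ w₂ h₁ h₂ h p q z :=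
  le_self_add

theorem le_mixture_right (w₁ w₂ : ℝ) (h₁ : 0 < w₁) (h₂ : 0 < w₂) (h : w₁ + w₂ = 1) (p q : PMF 𝒵)
    (z : 𝒵) : ENNReal.ofReal w₂ * q z ≤ mixture w₁ w₂ h₁ h₂ h p q z :=
  le_add_self

theorem prob_le_of_le_mul (p q : PMF 𝒵) {S : Set 𝒵} {c : ℝ} (hc : 0 ≤ c)
    (h : ∀ z ∈ S, (p z).toReal ≤ c * (q z).toReal) : prob p S ≤ c := by
  have hq := (hasSum_toReal q).mul_left c
  rw [mul_one] at hq
  refine hasSum_le (fun z => ?_) (summable_indicator_toReal p S).hasSum hq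
  by_cases hz : z ∈ S
  · rw [Set.indicator_of_mem hz]
    exact h z hz
  · rw [Set.indicator_of_notMem hz]
    have := (q z).toReal_nonneg
    positivity

/-- If `q n` dominates `w * p n`, then under `p n` the self-informations of `p n` and of `q n`
have the same limiting spectrum. -/
theorem tendsto_specTail_of_mul_le {𝒵ₙ : ℕ → Type*} {p q : ∀ n, PMF (𝒵ₙ n)} {a w : ℝ}
    (hw : 0 < w) (hpq : ∀ n z, ENNReal.ofReal w * p n z ≤ q n z) {g : ℝ → ℝ}
    (hg : Continuous g)
    (hlim : ∀ t, Tendsto (fun n => specTail (p n) (p n) a t n) atTop (𝓝 (g t))) (t : ℝ) :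
    Tendsto (fun n => specTail (p n) (q n) a t n) atTop (𝓝 (g t)) := by
  have hsqrt : Tendsto (fun n : ℕ => √(n : ℝ)) atTop atTop :=
    Real.tendsto_sqrt_atTop.comp tendsto_natCast_atTop_atTop
  have hpq' : ∀ n z, w * (p n z).toReal ≤ (q n z).toReal := fun n z => by
    have := ENNReal.toReal_mono ((q n).apply_ne_top z) (hpq n z)
    rwa [ENNReal.toReal_mul, ENNReal.toReal_ofReal hw.le] at this
  refine tendsto_order.2 ⟨fun b hb => ?_, fun b hb => ?_⟩
  -- Lower bound: where `p n` is below level `s` but `q n` is not below level `t`, `p n ≤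
  -- e^{-(s-t)√n} q n`, so this set has vanishing `p n`-mass.
  · obtain ⟨s, hts, hs⟩ : ∃ s, t < s ∧ b < g s := by
      have := (hg.continuousAt.eventually_const_lt hb).filter_mono
        (nhdsWithin_le_nhds (s := Set.Ioi t))
      exact (this.and self_mem_nhdsWithin).exists.imp fun s h => ⟨h.2, h.1⟩
    have h0 : Tendsto (fun n : ℕ => specTail (p n) (p n) a s n -
        Real.exp (-((s - t) * √(n : ℝ)))) atTop (𝓝 (g s - 0)) :=
      (hlim s).sub (tendsto_exp_neg_mul_sqrt (sub_pos.2 hts))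
    rw [sub_zero] at h0
    filter_upwards [h0.eventually_const_lt hs] with n hn
    refine hn.trans_le ?_
    rw [sub_le_iff_le_add]
    refine (prob_le_add (p n) (T := {z | (q n z).toReal < Real.exp (-(n * a + √(n : ℝ) * t))})
      (U := {z | (p n z).toReal < Real.exp (-(n * a + √(n : ℝ) * s)) ∧
        Real.exp (-(n * a + √(n : ℝ) * t)) ≤ (q n z).toReal}) fun z hz => ?_).trans
      (add_le_add le_rfl (prob_le_of_le_mul (p n) (q n) (Real.exp_pos _).le fun z hz => ?_))
    · rcases lt_or_ge (q n z).toReal (Real.exp (-(n * a + √(n : ℝ) * t))) with h | h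
      · exact Or.inl h
      · exact Or.inr ⟨hz, h⟩
    · calc (p n z).toReal ≤ Real.exp (-(n * a + √(n : ℝ) * s)) := hz.1.le
        _ = Real.exp (-((s - t) * √(n : ℝ))) * Real.exp (-(n * a + √(n : ℝ) * t)) := by
          rw [← Real.exp_add]
          ring_nf
        _ ≤ _ := by
          gcongr
          exact hz.2
  -- Upper bound: the factor `w` costs `-log w`, eventually absorbed by `√n (t - s)`.
  · obtain ⟨s, hts, hs⟩ : ∃ s, s < t ∧ g s < b := by
      have := (hg.continuousAt.eventually_lt_const hb).filter_mono
        (nhdsWithin_le_nhds (s := Set.Iio t))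
      exact (this.and self_mem_nhdsWithin).exists.imp fun s h => ⟨h.2, h.1⟩
    filter_upwards [(hlim s).eventually_lt_const hs,
      (hsqrt.atTop_mul_const (sub_pos.2 hts)).eventually_ge_atTop (-Real.log w)] with n hn hw'
    refine lt_of_le_of_lt (prob_mono _ fun z hz => ?_) hn
    simp only [Set.mem_ofPred_eq] at hz ⊢
    have h1 : Real.exp (-(n * a + √(n : ℝ) * t)) ≤ w * Real.exp (-(n * a + √(n : ℝ) * s)) := by
      nth_rewrite 1 [← Real.exp_log hw]
      rw [← Real.exp_add, Real.exp_le_exp]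
      linarith
    exact lt_of_mul_lt_mul_left ((hpq' n z).trans_lt (hz.trans_le h1)) hw.le

theorem tendsto_specTail_mixedSource (w₁ w₂ : ℝ) (h₁ : 0 < w₁) (h₂ : 0 < w₂) (h : w₁ + w₂ = 1)
    (P₁ P₂ : PMF 𝒴) {a : ℝ} {g₁ g₂ : ℝ → ℝ} (hg₁ : Continuous g₁) (hg₂ : Continuous g₂)
    (hlim₁ : ∀ t, Tendsto (fun n => specTail (iidSource P₁ n) (iidSource P₁ n) a t n) atTop
      (𝓝 (g₁ t)))
    (hlim₂ : ∀ t, Tendsto (fun n => specTail (iidSource P₂ n) (iidSource P₂ n) a t n) atTop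
      (𝓝 (g₂ t))) (t : ℝ) :
    Tendsto (fun n => specTail (mixedSource w₁ w₂ h₁ h₂ h P₁ P₂ n)
      (mixedSource w₁ w₂ h₁ h₂ h P₁ P₂ n) a t n) atTop (𝓝 (w₁ * g₁ t + w₂ * g₂ t)) := by
  have e₁ := tendsto_specTail_of_mul_le (q := mixedSource w₁ w₂ h₁ h₂ h P₁ P₂) h₁
    (fun n z => le_mixture_left w₁ w₂ h₁ h₂ h (iidSource P₁ n) (iidSource P₂ n) z) hg₁ hlim₁ t
  have e₂ := tendsto_specTail_of_mul_le (q := mixedSource w₁ w₂ h₁ h₂ h P₁ P₂) h₂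
    (fun n z => le_mixture_right w₁ w₂ h₁ h₂ h (iidSource P₁ n) (iidSource P₂ n) z) hg₂ hlim₂ t
  exact ((e₁.const_mul w₁).add (e₂.const_mul w₂)).congr fun n =>
    (prob_mixture w₁ w₂ h₁ h₂ h _ _ _).symm

/-! ### The Gaussian tail on the extended reals -/

theorem gaussianPDFReal_zero_one (z : ℝ) : gaussianPDFReal 0 1 z =
    1 / √(2 * Real.pi) * Real.exp (-z ^ 2 / 2) := by
  simp [gaussianPDFReal]

theorem gaussianTail_eq (x : EReal) : gaussianTail x =
    ∫ z in {z : ℝ | x ≤ (z : EReal)}, gaussianPDFReal 0 1 z := by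
  simp only [gaussianTail, gaussianPDFReal_zero_one]

theorem measurableSet_le_coe (x : EReal) : MeasurableSet {z : ℝ | x ≤ (z : EReal)} :=
  measurable_coe_real_ereal measurableSet_Ici

theorem gaussianTail_top : gaussianTail ⊤ = 0 := by
  simp [gaussianTail]

theorem gaussianTail_bot : gaussianTail ⊥ = 1 := by
  rw [gaussianTail_eq]
  simpa using integral_gaussianPDFReal_eq_one 0 one_ne_zero

theorem gaussianTail_coe (x : ℝ) :
    gaussianTail x = (gaussianReal 0 1).real (Set.Ici x) := by
  rw [gaussianTail_eq, Measure.real,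
    gaussianReal_apply_eq_integral 0 one_ne_zero, ENNReal.toReal_ofReal
    (integral_nonneg fun z => gaussianPDFReal_nonneg 0 1 z)]
  simp only [EReal.coe_le_coe_iff]
  rfl

theorem strictAnti_gaussianTail : StrictAnti gaussianTail := by
  intro x y hxy
  have hint : Integrable (gaussianPDFReal 0 1) volume :=
    integrable_gaussianPDFReal 0 1
  obtain ⟨r, hxr, hry⟩ := EReal.lt_iff_exists_real_btwn.1 hxy
  obtain ⟨s, hrs, hsy⟩ := EReal.lt_iff_exists_real_btwn.1 hry
  rw [EReal.coe_lt_coe_iff] at hrs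
  have hdisj : Disjoint {z : ℝ | y ≤ (z : EReal)} (Set.Ioo r s) := by
    refine Set.disjoint_left.2 fun z hz hz' => ?_
    exact ((hz.trans_lt (EReal.coe_lt_coe_iff.2 hz'.2)).trans hsy).false
  have hpos : 0 < ∫ z in Set.Ioo r s, gaussianPDFReal 0 1 z := by
    rw [setIntegral_pos_iff_support_of_nonneg_ae
      (ae_of_all _ fun z => gaussianPDFReal_nonneg 0 1 z) hint.integrableOn]
    have : Function.support (gaussianPDFReal 0 1) = Set.univ := by
      ext z
      simp [(gaussianPDFReal_pos 0 1 z one_ne_zero).ne']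
    rw [this, Set.univ_inter, Real.volume_Ioo]
    simpa using hrs
  rw [gaussianTail_eq, gaussianTail_eq]
  calc _ < (∫ z in {z : ℝ | y ≤ (z : EReal)}, gaussianPDFReal 0 1 z) +
        ∫ z in Set.Ioo r s, gaussianPDFReal 0 1 z := by linarith
    _ = ∫ z in {z : ℝ | y ≤ (z : EReal)} ∪ Set.Ioo r s,
          gaussianPDFReal 0 1 z :=
        (setIntegral_union hdisj measurableSet_Ioo hint.integrableOn hint.integrableOn).symm
    _ ≤ _ := by
        refine setIntegral_mono_set hint.integrableOn
          (ae_of_all _ fun z => gaussianPDFReal_nonneg 0 1 z)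
          (LE.le.eventuallyLE ?_)
        rintro z (hz | hz)
        · exact hxy.le.trans hz
        · exact (hxr.trans (EReal.coe_lt_coe_iff.2 hz.1)).le

/-- Dominated convergence: for each `z` other than the limit point, the indicator is locally
constant in the endpoint. -/
theorem continuous_gaussianTail : Continuous gaussianTail := by
  refine continuous_iff_continuousAt.2 fun x => ?_
  have h : gaussianTail = fun x => ∫ z, {z : ℝ | x ≤ (z : EReal)}.indicator
      (gaussianPDFReal 0 1) z := by
    funext x
    rw [gaussianTail_eq, integral_indicator (measurableSet_le_coe x)]
  rw [h]
  refine continuousAt_of_dominated (bound := gaussianPDFReal 0 1)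
    (Eventually.of_forall fun y => ?_) (Eventually.of_forall fun y => ae_of_all _ fun z => ?_)
    (integrable_gaussianPDFReal 0 1) ?_
  · exact ((measurable_gaussianPDFReal 0 1).indicator
      (measurableSet_le_coe y)).aestronglyMeasurable
  · refine (norm_indicator_le_norm_self _ _).trans ?_
    rw [Real.norm_of_nonneg (gaussianPDFReal_nonneg 0 1 z)]
  · have : ∀ᵐ z : ℝ, (z : EReal) ≠ x := by
      refine (Set.Subsingleton.countable ?_).ae_notMem volume (s := {z : ℝ | (z : EReal) = x})
      intro z hz z' hz'
      exact EReal.coe_injective (hz.trans hz'.symm)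
    filter_upwards [this] with z hz
    rcases lt_or_gt_of_ne hz with hlt | hgt
    · refine continuousAt_const (y := (0 : ℝ)) |>.congr ?_
      filter_upwards [lt_mem_nhds hlt] with y hy
      rw [Set.indicator_of_notMem (by simpa using hy)]
    · refine continuousAt_const (y := gaussianPDFReal 0 1 z) |>.congr ?_
      filter_upwards [gt_mem_nhds hgt] with y hy
      rw [Set.indicator_of_mem (by simpa using hy.le)]

theorem strictAnti_gaussianTail_div {σ : ℝ} (hσ : 0 < σ) :
    StrictAnti fun T : EReal => gaussianTail (T / (σ : EReal)) :=
  strictAnti_gaussianTail.comp_strictMono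
    (EReal.strictMono_div_right_of_pos (EReal.coe_pos.2 hσ) (EReal.coe_ne_top σ))

theorem continuous_gaussianTail_div {σ : ℝ} (hσ : 0 < σ) :
    Continuous fun T : EReal => gaussianTail (T / (σ : EReal)) := by
  refine continuous_gaussianTail.comp (Monotone.continuous_of_surjective
    (EReal.strictMono_div_right_of_pos (EReal.coe_pos.2 hσ) (EReal.coe_ne_top σ)).monotone
    fun y => ⟨y * σ, ?_⟩)
  rw [← EReal.mul_div_right, EReal.div_mul_cancel (EReal.coe_ne_bot σ) (EReal.coe_ne_top σ)
    (EReal.coe_ne_zero.2 hσ.ne')]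

theorem gaussianTail_top_div {σ : ℝ} (hσ : 0 < σ) : gaussianTail (⊤ / (σ : EReal)) = 0 := by
  rw [EReal.top_div_of_pos_ne_top (EReal.coe_pos.2 hσ) (EReal.coe_ne_top σ), gaussianTail_top]

theorem gaussianTail_bot_div {σ : ℝ} (hσ : 0 < σ) : gaussianTail (⊥ / (σ : EReal)) = 1 := by
  rw [EReal.bot_div_of_pos_ne_top (EReal.coe_pos.2 hσ) (EReal.coe_ne_top σ), gaussianTail_bot]

/-- A continuous strictly decreasing function on the extended reals takes every value between
its extreme values exactly once. -/
theorem existsUnique_eq_of_strictAnti {F : EReal → ℝ} (hF : StrictAnti F) (hc : Continuous F)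
    {b : ℝ} (htop : F ⊤ ≤ b) (hbot : b ≤ F ⊥) : ∃! T, b = F T := by
  obtain ⟨T, hT⟩ := mem_range_of_exists_le_of_exists_ge hc ⟨⊤, htop⟩ ⟨⊥, hbot⟩
  exact ⟨T, hT.symm, fun S hS => hF.injective (hS.symm.trans hT.symm)⟩

/-- The second-order resolvability solves the equation given by the limiting information
spectrum. -/
theorem existsUnique_and_resolvability_eq {𝒴ₙ : ℕ → Type*} {a δ : ℝ} {Y : ∀ n, PMF (𝒴ₙ n)}
    (ha : 0 < a) {F : EReal → ℝ} (hF : StrictAnti F) (hc : Continuous F)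
    (hlim : ∀ t : ℝ, Tendsto (fun n => specTail (Y n) (Y n) a t n) atTop (𝓝 (F t)))
    (htop : F ⊤ ≤ δ / 2) (hbot : δ / 2 ≤ F ⊥) :
    (∃! T, δ / 2 = F T) ∧ ∀ T, δ / 2 = F T → resolvability a δ Y = T :=
  ⟨existsUnique_eq_of_strictAnti hF hc htop hbot, fun _ hT =>
    resolvability_eq_of_tendsto_specTail ha hlim (fun _ ht => hT ▸ hF ht) fun _ ht => hT ▸ hF ht⟩

/-! ### Self-information of i.i.d. letters -/

theorem selfInfo_nonneg (P : PMF 𝒴) (y : 𝒴) : 0 ≤ selfInfo P y := by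
  have h1 : (P y).toReal ≤ 1 :=
    ENNReal.toReal_le_of_le_ofReal zero_le_one (by simpa using P.coe_le_one y)
  rw [selfInfo, one_div, Real.log_inv, neg_nonneg]
  exact Real.log_nonpos ENNReal.toReal_nonneg h1

theorem varentropy_eq_zero_of_entropy_eq_zero {P : PMF 𝒴} (hP : FiniteVarentropy P)
    (h : entropy P = 0) : varentropy P = 0 := by
  have hs := hP.1.hasSum
  rw [show ∑' y, (P y).toReal * selfInfo P y = 0 from h] at hs
  have h0 := (hasSum_zero_iff_of_nonneg fun y =>
    mul_nonneg (P y).toReal_nonneg (selfInfo_nonneg P y)).1 hs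
  rw [varentropy, tsum_congr (g := fun _ => (0 : ℝ)), tsum_zero]
  intro y
  have hy : (P y).toReal * selfInfo P y = 0 := congrFun h0 y
  rw [h, sub_zero, sq, ← mul_assoc, hy, zero_mul]

/-- Supplies the hypothesis `0 < a`: zero entropy makes every term of the entropy series vanish, and
with it the varentropy. -/
theorem entropy_pos_of_sigma_pos {P : PMF 𝒴} (hP : FiniteVarentropy P) (h : 0 < sigma P) :
    0 < entropy P := by
  refine lt_of_le_of_ne
    (tsum_nonneg fun y => mul_nonneg (P y).toReal_nonneg (selfInfo_nonneg P y)) fun h0 => ?_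
  rw [sigma, varentropy_eq_zero_of_entropy_eq_zero hP h0.symm, Real.sqrt_zero] at h
  exact h.false

/-- The law of an infinite sequence of i.i.d. letters. -/
def iidMeasure [MeasurableSpace 𝒴] (P : PMF 𝒴) : Measure (ℕ → 𝒴) :=
  Measure.infinitePi fun _ => P.toMeasure

instance [MeasurableSpace 𝒴] (P : PMF 𝒴) : IsProbabilityMeasure (iidMeasure P) := by
  unfold iidMeasure
  infer_instance

theorem iIndepFun_eval_iidMeasure [MeasurableSpace 𝒴] (P : PMF 𝒴) :
    iIndepFun (fun k (ω : ℕ → 𝒴) => ω k) (iidMeasure P) :=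
  iIndepFun_infinitePi (X := fun _ y => y) fun _ => measurable_id

theorem map_eval_iidMeasure [MeasurableSpace 𝒴] (P : PMF 𝒴) (k : ℕ) :
    (iidMeasure P).map (fun ω => ω k) = P.toMeasure :=
  Measure.infinitePi_map_eval _ k

theorem identDistrib_eval [MeasurableSpace 𝒴] (P : PMF 𝒴) (k : ℕ) :
    IdentDistrib (fun ω : ℕ → 𝒴 => ω k) id (iidMeasure P) P.toMeasure :=
  ⟨(measurable_pi_apply k).aemeasurable, aemeasurable_id, by
    rw [map_eval_iidMeasure, Measure.map_id]⟩

/-- Letters of mass zero must be discarded because `Real.log 0 = 0` gives them self-information 0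
instead of `+∞`. -/
theorem ae_ne_zero_iidMeasure [MeasurableSpace 𝒴] [DiscreteMeasurableSpace 𝒴] (P : PMF 𝒴) :
    ∀ᵐ ω ∂iidMeasure P, ∀ k, P (ω k) ≠ 0 := by
  refine ae_all_iff.2 fun k => ?_
  have h : ∀ᵐ y ∂P.toMeasure, P y ≠ 0 := by
    rw [ae_iff, P.toMeasure_apply_eq_zero_iff MeasurableSet.of_discrete, Set.disjoint_left]
    intro y hy hy'
    exact hy' hy
  rw [← map_eval_iidMeasure P k] at h
  exact ae_of_ae_map (measurable_pi_apply k).aemeasurable h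

theorem iIndepFun_selfInfo [MeasurableSpace 𝒴] [DiscreteMeasurableSpace 𝒴] (P : PMF 𝒴) :
    iIndepFun (fun k (ω : ℕ → 𝒴) => selfInfo P (ω k)) (iidMeasure P) :=
  (iIndepFun_eval_iidMeasure P).comp (fun _ => selfInfo P) fun _ => .of_discrete

theorem identDistrib_selfInfo [MeasurableSpace 𝒴] [DiscreteMeasurableSpace 𝒴] (P : PMF 𝒴)
    (k : ℕ) :
    IdentDistrib (fun ω : ℕ → 𝒴 => selfInfo P (ω k)) (selfInfo P) (iidMeasure P) P.toMeasure :=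
  (identDistrib_eval P k).comp (u := selfInfo P) .of_discrete

section Discrete

variable [Countable 𝒴] [MeasurableSpace 𝒴] [DiscreteMeasurableSpace 𝒴]

theorem integrable_toMeasure_of_nonneg (P : PMF 𝒴) {f : 𝒴 → ℝ} (hf : 0 ≤ f)
    (h : Summable fun y => (P y).toReal * f y) : Integrable f P.toMeasure := by
  refine ⟨(Measurable.of_discrete (f := f)).aestronglyMeasurable, ?_⟩
  rw [hasFiniteIntegral_iff_ofReal (ae_of_all _ hf), lintegral_countable']
  have : ∀ y, ENNReal.ofReal (f y) * P.toMeasure {y} =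
      ENNReal.ofReal ((P y).toReal * f y) := fun y => by
    rw [P.toMeasure_apply_singleton y (MeasurableSet.singleton y),
      ENNReal.ofReal_mul ENNReal.toReal_nonneg, ENNReal.ofReal_toReal (P.apply_ne_top y),
      mul_comm]
  simp_rw [this]
  rw [← ENNReal.ofReal_tsum_of_nonneg (fun y => mul_nonneg (P y).toReal_nonneg (hf y)) h]
  exact ENNReal.ofReal_lt_top

theorem integral_selfInfo {P : PMF 𝒴} (hP : FiniteVarentropy P) :
    ∫ y, selfInfo P y ∂P.toMeasure = entropy P := by
  rw [PMF.integral_eq_tsum P _ (integrable_toMeasure_of_nonneg P (selfInfo_nonneg P) hP.1)]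
  rfl

theorem memLp_selfInfo {P : PMF 𝒴} (hP : FiniteVarentropy P) :
    MemLp (selfInfo P) 2 P.toMeasure := by
  have h : MemLp (fun y => selfInfo P y - entropy P) 2 P.toMeasure :=
    (memLp_two_iff_integrable_sq (Measurable.of_discrete.aestronglyMeasurable)).2
      (integrable_toMeasure_of_nonneg P (fun y => sq_nonneg _) hP.2)
  have := h.add (memLp_const (entropy P))
  simpa [Pi.add_def] using this

theorem variance_selfInfo {P : PMF 𝒴} (hP : FiniteVarentropy P) :
    Var[selfInfo P; P.toMeasure] = varentropy P := by
  rw [variance_eq_integral (Measurable.of_discrete.aemeasurable), integral_selfInfo hP,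
    PMF.integral_eq_tsum P _ (integrable_toMeasure_of_nonneg P (fun y => sq_nonneg _) hP.2)]
  rfl

theorem prob_eq_toMeasure_real [MeasurableSpace 𝒵] [DiscreteMeasurableSpace 𝒵] (p : PMF 𝒵)
    (S : Set 𝒵) : prob p S = p.toMeasure.real S := by
  rw [Measure.real, p.toMeasure_apply (MeasurableSet.of_discrete), ENNReal.tsum_toReal_eq, prob]
  · refine tsum_congr fun z => ?_
    by_cases hz : z ∈ S
    · simp [hz]
    · simp [hz]
  · intro z
    by_cases hz : z ∈ S
    · simp [hz, p.apply_ne_top z]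
    · simp [hz]

/-- Realises all the `n`-letter laws on one probability space, where the limit theorems apply. -/
theorem map_restrict_iidMeasure (P : PMF 𝒴) (n : ℕ) :
    (iidMeasure P).map (fun ω (k : Fin n) => ω k) = (iidSource P n).toMeasure := by
  have h := (iIndepFun_iff_map_fun_eq_pi_map
    (fun k : Fin n => (measurable_pi_apply (k : ℕ)).aemeasurable)).1
    ((iIndepFun_eval_iidMeasure P).precomp (g := fun k : Fin n => (k : ℕ)) Fin.val_injective)
  rw [h]
  simp_rw [map_eval_iidMeasure]
  refine Measure.ext_of_singleton fun y => ?_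
  rw [Measure.pi_singleton, PMF.toMeasure_apply_singleton _ _ (MeasurableSet.singleton y)]
  exact Finset.prod_congr rfl fun k _ =>
    P.toMeasure_apply_singleton _ (MeasurableSet.singleton _)

theorem specTail_iidSource (P : PMF 𝒴) (a t : ℝ) (n : ℕ) :
    specTail (iidSource P n) (iidSource P n) a t n =
      (iidMeasure P).real {ω | n * a + √(n : ℝ) * t <
        ∑ k ∈ Finset.range n, selfInfo P (ω k)} := by
  rw [specTail, prob_eq_toMeasure_real, ← map_restrict_iidMeasure,
    map_measureReal_apply (by fun_prop) MeasurableSet.of_discrete]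
  refine measureReal_congr ?_
  filter_upwards [ae_ne_zero_iidMeasure P] with ω hω
  have hpos : ∀ k, 0 < (P (ω k)).toReal := fun k =>
    ENNReal.toReal_pos (hω k) (P.apply_ne_top _)
  have hval : ((iidSource P n) fun k : Fin n => ω k).toReal =
      ∏ k ∈ Finset.range n, (P (ω k)).toReal := by
    rw [← Fin.prod_univ_eq_prod_range (fun k => (P (ω k)).toReal) n, ← ENNReal.toReal_prod]
    rfl
  have hsum : ∑ k ∈ Finset.range n, selfInfo P (ω k) =
      -Real.log (∏ k ∈ Finset.range n, (P (ω k)).toReal) := by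
    rw [Real.log_prod fun k _ => (hpos k).ne', ← Finset.sum_neg_distrib]
    simp [selfInfo]
  refine propext ?_
  change ((iidSource P n) fun k : Fin n => ω k).toReal < _ ↔ _ < _
  rw [hval, hsum, lt_neg, ← Real.log_lt_iff_lt_exp (Finset.prod_pos fun k _ => hpos k)]

/-! ### Limit theorems for the i.i.d. spectrum -/

/-- After division by `n` the threshold is `a + t/√n → a`, while the averages tend almost surely to
the entropy; the indicators of the events thus converge almost surely to 0 or 1. -/
theorem tendsto_specTail_of_lt_of_gt {P : PMF 𝒴} (hP : FiniteVarentropy P) {a : ℝ}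
    (t : ℝ) {g : ℝ} (h : (entropy P < a ∧ g = 0) ∨ (a < entropy P ∧ g = 1)) :
    Tendsto (fun n => specTail (iidSource P n) (iidSource P n) a t n) atTop (𝓝 g) := by
  have hint := integrable_toMeasure_of_nonneg P (selfInfo_nonneg P) hP.1
  have hlaw := strong_law_ae_real (μ := iidMeasure P) (fun k ω => selfInfo P (ω k))
    ((identDistrib_selfInfo P 0).integrable_iff.2 hint)
    (fun i j hij => (iIndepFun_selfInfo P).indepFun hij)
    (fun i => (identDistrib_selfInfo P i).trans (identDistrib_selfInfo P 0).symm)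
  rw [(identDistrib_selfInfo P 0).integral_eq, integral_selfInfo hP] at hlaw
  have hth : Tendsto (fun n : ℕ => a + t / √(n : ℝ)) atTop (𝓝 a) := by
    simpa using ((Real.tendsto_sqrt_atTop.comp
      tendsto_natCast_atTop_atTop).const_div_atTop t).const_add a
  have hiff : ∀ (n : ℕ), 0 < n → ∀ s : ℝ, n * a + √(n : ℝ) * t < s ↔
      a + t / √(n : ℝ) < s / n := fun n hn s => by
    have hn' : (0 : ℝ) < n := by exact_mod_cast hn
    rw [lt_div_iff₀ hn']
    have : (a + t / √(n : ℝ)) * n = n * a + √(n : ℝ) * t := by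
      have hs : √(n : ℝ) ≠ 0 := (Real.sqrt_pos.2 hn').ne'
      have hsq := Real.mul_self_sqrt hn'.le
      field_simp
      linear_combination -t * hsq
    rw [this]
  have hmeas : ∀ n : ℕ, MeasurableSet {ω : ℕ → 𝒴 | n * a + √(n : ℝ) * t <
      ∑ k ∈ Finset.range n, selfInfo P (ω k)} := fun n => by
    refine measurableSet_lt measurable_const (Finset.measurable_sum _ fun k _ => ?_)
    exact (Measurable.of_discrete (f := selfInfo P)).comp (measurable_pi_apply k)
  simp_rw [specTail_iidSource]
  rcases h with ⟨ha, rfl⟩ | ⟨ha, rfl⟩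
  · have := tendsto_measure_of_ae_tendsto_indicator_of_isFiniteMeasure (μ := iidMeasure P) atTop
      MeasurableSet.empty hmeas (by
        filter_upwards [hlaw] with ω hω
        filter_upwards [hω.eventually_lt hth ha, eventually_gt_atTop 0] with n hn hn0
        simpa [hiff n hn0] using hn.le)
    simpa [Measure.real, Function.comp_def] using (ENNReal.tendsto_toReal (measure_ne_top _ _)).comp this
  · have := tendsto_measure_of_ae_tendsto_indicator_of_isFiniteMeasure (μ := iidMeasure P) atTop
      MeasurableSet.univ hmeas (by
        filter_upwards [hlaw] with ω hω
        filter_upwards [hth.eventually_lt hω ha, eventually_gt_atTop 0] with n hn hn0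
        simpa [hiff n hn0] using hn)
    simpa [Measure.real, Function.comp_def] using (ENNReal.tendsto_toReal (measure_ne_top _ _)).comp this

theorem gaussianReal_real_Ioi {σ : ℝ} (hσ : 0 < σ) (t : ℝ) :
    (gaussianReal 0 (σ ^ 2).toNNReal).real (Set.Ioi t) = gaussianTail ((t / σ : ℝ) : EReal) := by
  have h := gaussianReal_map_const_mul (μ := 0) (v := 1) σ
  rw [mul_zero] at h
  rw [mul_one, show NNReal.mk (σ ^ 2) (sq_nonneg σ) = (σ ^ 2).toNNReal from
    NNReal.eq (by simp [sq_nonneg])] at h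
  rw [gaussianTail_coe, ← h]
  rw [map_measureReal_apply (by fun_prop) measurableSet_Ioi]
  have : (fun x => σ * x) ⁻¹' Set.Ioi t = Set.Ioi (t / σ) := by
    ext x
    simp [div_lt_iff₀' hσ]
  rw [this]
  have := nullSingletonClass_gaussianReal (μ := 0) (v := 1) one_ne_zero
  exact measureReal_congr Ioi_ae_eq_Ici

theorem tendsto_specTail_entropy {P : PMF 𝒴} (hP : FiniteVarentropy P) (hσ : 0 < sigma P)
    (t : ℝ) :
    Tendsto (fun n => specTail (iidSource P n) (iidSource P n) (entropy P) t n) atTop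
      (𝓝 (gaussianTail ((t : EReal) / (sigma P : EReal)))) := by
  have hvar : Var[fun ω : ℕ → 𝒴 => selfInfo P (ω 0); iidMeasure P] = sigma P ^ 2 := by
    rw [(identDistrib_selfInfo P 0).variance_eq, variance_selfInfo hP, sigma]
    exact (Real.sq_sqrt
      (tsum_nonneg fun y => mul_nonneg (P y).toReal_nonneg (sq_nonneg _))).symm
  have hclt := tendstoInDistribution_inv_sqrt_mul_sum_sub (P := iidMeasure P)
    (X := fun k ω => selfInfo P (ω k)) (Y := id)
    (P' := gaussianReal 0 (sigma P ^ 2).toNNReal)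
    (by rw [hvar]; exact HasLaw.id)
    ((identDistrib_selfInfo P 0).memLp_iff.2 (memLp_selfInfo hP)) (iIndepFun_selfInfo P)
    (fun i => (identDistrib_selfInfo P i).trans (identDistrib_selfInfo P 0).symm)
  rw [(identDistrib_selfInfo P 0).integral_eq, integral_selfInfo hP] at hclt
  have := nullSingletonClass_gaussianReal (μ := 0) (v := (sigma P ^ 2).toNNReal) (by simpa using hσ.ne')
  -- The frontier of the half-line is `{t}`, null for a Gaussian law of nonzero variance.
  have hport := ProbabilityMeasure.tendsto_measure_of_null_frontier_of_tendsto' hclt.tendsto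
    (E := Set.Ioi t) (by simp)
  simp only [ProbabilityMeasure.coe_mk, Measure.map_id] at hport
  have h2 := (ENNReal.tendsto_toReal (measure_ne_top _ _)).comp hport
  rw [← EReal.coe_div, ← gaussianReal_real_Ioi hσ]
  refine h2.congr' ?_
  filter_upwards [eventually_gt_atTop 0] with n hn
  have hs : 0 < √(n : ℝ) := Real.sqrt_pos.2 (by exact_mod_cast hn)
  rw [specTail_iidSource, Function.comp_apply,
    Measure.map_apply_of_aemeasurable (hclt.forall_aemeasurable n) measurableSet_Ioi]
  congr 2
  ext ω
  simp only [Set.mem_preimage, Set.mem_Ioi, Set.mem_ofPred_eq]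
  rw [lt_inv_mul_iff₀ hs]
  constructor <;> intro h <;> linarith

end Discrete

end SecondOrder

end

/-! ### The three cases -/

theorem theorem5 {𝒴 : Type*} [Countable 𝒴] (P₁ P₂ : PMF 𝒴)
    (hP₁ : SecondOrder.FiniteVarentropy P₁) (hP₂ : SecondOrder.FiniteVarentropy P₂)
    (w₁ w₂ : ℝ) (hw₁ : 0 < w₁) (hw₂ : 0 < w₂) (hw : w₁ + w₂ = 1)
    (δ : ℝ) (hδ₀ : 0 ≤ δ) (hδ₂ : δ < 2) :
    -- Case I
    (SecondOrder.entropy P₁ = SecondOrder.entropy P₂ →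
      0 < SecondOrder.sigma P₁ → 0 < SecondOrder.sigma P₂ →
      (∃! T : EReal, δ / 2 =
        w₁ * SecondOrder.gaussianTail (T / (SecondOrder.sigma P₁ : EReal)) +
          w₂ * SecondOrder.gaussianTail (T / (SecondOrder.sigma P₂ : EReal))) ∧
      ∀ T : EReal, δ / 2 =
        w₁ * SecondOrder.gaussianTail (T / (SecondOrder.sigma P₁ : EReal)) +
          w₂ * SecondOrder.gaussianTail (T / (SecondOrder.sigma P₂ : EReal)) →
        SecondOrder.resolvability (SecondOrder.entropy P₁) δ
          (SecondOrder.mixedSource w₁ w₂ hw₁ hw₂ hw P₁ P₂) = T) ∧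
    -- Case II
    (SecondOrder.entropy P₂ < SecondOrder.entropy P₁ → δ / 2 < w₁ →
      0 < SecondOrder.sigma P₁ →
      (∃! T : EReal, δ / 2 =
        w₁ * SecondOrder.gaussianTail (T / (SecondOrder.sigma P₁ : EReal))) ∧
      ∀ T : EReal, δ / 2 =
        w₁ * SecondOrder.gaussianTail (T / (SecondOrder.sigma P₁ : EReal)) →
        SecondOrder.resolvability (SecondOrder.entropy P₁) δ
          (SecondOrder.mixedSource w₁ w₂ hw₁ hw₂ hw P₁ P₂) = T) ∧
    -- Case III
    (SecondOrder.entropy P₂ < SecondOrder.entropy P₁ → w₁ < δ / 2 →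
      0 < SecondOrder.sigma P₂ →
      (∃! T : EReal, δ / 2 =
        w₁ + w₂ * SecondOrder.gaussianTail (T / (SecondOrder.sigma P₂ : EReal))) ∧
      ∀ T : EReal, δ / 2 =
        w₁ + w₂ * SecondOrder.gaussianTail (T / (SecondOrder.sigma P₂ : EReal)) →
        SecondOrder.resolvability (SecondOrder.entropy P₂) δ
          (SecondOrder.mixedSource w₁ w₂ hw₁ hw₂ hw P₁ P₂) = T) := by
  -- The discrete σ-algebra makes every function of a letter measurable.
  let _ : MeasurableSpace 𝒴 := ⊤
  have _ : DiscreteMeasurableSpace 𝒴 := ⟨fun _ => trivial⟩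
  refine ⟨fun hH hσ₁ hσ₂ => ?_, fun hH hδ hσ₁ => ?_, fun hH hδ hσ₂ => ?_⟩
  · refine SecondOrder.existsUnique_and_resolvability_eq
      (F := fun T => w₁ * SecondOrder.gaussianTail (T / (SecondOrder.sigma P₁ : EReal)) +
          w₂ * SecondOrder.gaussianTail (T / (SecondOrder.sigma P₂ : EReal)))
      (SecondOrder.entropy_pos_of_sigma_pos hP₁ hσ₁)
      (((SecondOrder.strictAnti_gaussianTail_div hσ₁).const_mul hw₁).add
        ((SecondOrder.strictAnti_gaussianTail_div hσ₂).const_mul hw₂))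
      (((SecondOrder.continuous_gaussianTail_div hσ₁).const_mul w₁).add
        ((SecondOrder.continuous_gaussianTail_div hσ₂).const_mul w₂))
      (SecondOrder.tendsto_specTail_mixedSource w₁ w₂ hw₁ hw₂ hw P₁ P₂
        ((SecondOrder.continuous_gaussianTail_div hσ₁).comp continuous_coe_real_ereal)
        ((SecondOrder.continuous_gaussianTail_div hσ₂).comp continuous_coe_real_ereal)
        (SecondOrder.tendsto_specTail_entropy hP₁ hσ₁)
        (hH ▸ SecondOrder.tendsto_specTail_entropy hP₂ hσ₂)) ?_ ?_
    · simp only [SecondOrder.gaussianTail_top_div hσ₁, SecondOrder.gaussianTail_top_div hσ₂]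
      linarith
    · simp only [SecondOrder.gaussianTail_bot_div hσ₁, SecondOrder.gaussianTail_bot_div hσ₂]
      linarith
  · have hlim := SecondOrder.tendsto_specTail_mixedSource w₁ w₂ hw₁ hw₂ hw P₁ P₂
      -- `H(Y₂)` lies below the centring `H(Y₁)`, so the second component contributes nothing.
      (g₂ := fun _ => 0)
      ((SecondOrder.continuous_gaussianTail_div hσ₁).comp continuous_coe_real_ereal)
      continuous_const (SecondOrder.tendsto_specTail_entropy hP₁ hσ₁)
      (fun t => SecondOrder.tendsto_specTail_of_lt_of_gt hP₂ t (Or.inl ⟨hH, rfl⟩))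
    simp only [mul_zero, add_zero] at hlim
    refine SecondOrder.existsUnique_and_resolvability_eq
      (F := fun T => w₁ * SecondOrder.gaussianTail (T / (SecondOrder.sigma P₁ : EReal)))
      (SecondOrder.entropy_pos_of_sigma_pos hP₁ hσ₁)
      ((SecondOrder.strictAnti_gaussianTail_div hσ₁).const_mul hw₁)
      ((SecondOrder.continuous_gaussianTail_div hσ₁).const_mul w₁) hlim ?_ ?_
    · simp only [SecondOrder.gaussianTail_top_div hσ₁]
      linarith
    · simp only [SecondOrder.gaussianTail_bot_div hσ₁]
      linarith
  · have hlim := SecondOrder.tendsto_specTail_mixedSource w₁ w₂ hw₁ hw₂ hw P₁ P₂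
      -- `H(Y₁)` lies above the centring `H(Y₂)`, so the first component contributes its whole
      -- weight.
      (g₁ := fun _ => 1) continuous_const
      ((SecondOrder.continuous_gaussianTail_div hσ₂).comp continuous_coe_real_ereal)
      (fun t => SecondOrder.tendsto_specTail_of_lt_of_gt hP₁ t (Or.inr ⟨hH, rfl⟩))
      (SecondOrder.tendsto_specTail_entropy hP₂ hσ₂)
    simp only [mul_one] at hlim
    refine SecondOrder.existsUnique_and_resolvability_eq
      (F := fun T => w₁ + w₂ * SecondOrder.gaussianTail (T / (SecondOrder.sigma P₂ : EReal)))
      (SecondOrder.entropy_pos_of_sigma_pos hP₂ hσ₂)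
      (((SecondOrder.strictAnti_gaussianTail_div hσ₂).const_mul hw₂).const_add w₁)
      (((SecondOrder.continuous_gaussianTail_div hσ₂).const_mul w₂).const_add w₁) hlim ?_ ?_
    · simp only [SecondOrder.gaussianTail_top_div hσ₂]
      linarith
    · simp only [SecondOrder.gaussianTail_bot_div hσ₂]
      linarith
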